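/- **Theorem 3.1.** Let $\sigma>1$. Let $W$ be the Lambert function on $[0,\infty)$, i.e. the inverse of $w\mapsto we^w$ on $[0,\infty)$. For $\tau>0$ let $\mathcal D_{\tau,\sigma}(\mathbb R)$ be the set of compactly supported $\phi\in C^\infty(\mathbb R)$ such that for every compact $K\subset\mathbb R$ there are $C,h>0$ with $|\phi^{(p)}(x)|\le C\,h^{p^\sigma}p^{\tau p^\sigma}$ for all $x\in K$ and $p\in\mathbb N_0$ (with $p^{\tau p^\sigma}=1$ for $p=0$), and let $\mathcal D_\sigma(\mathbb R)=\bigcap_{\tau>0}\mathcal D_{\tau,\sigma}(\mathbb R)$. Let $\psi\in C^\infty(\mathbb R)$ be a complex-valued orthonormal wavelet, i.e. the functions $\psi_{m,n}(x)=2^{m/2}\psi(2^mx-n)$, $m,n\in\mathbb Z$, form an orthonormal basis of $L^2(\mathbb R)$, and let $\widehat\psi$ be its Fourier transform, $\widehat\psi(\xi)=\int_{\mathbb R}\psi(x)e^{ix\xi}\,dx$, extended to $L^2(\mathbb R)$. (a) Suppose that $\widehat\psi(\xi)=e^{i\xi/2}b_a(\xi)$, where $0<a<\pi/3$, $b_a$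 is even, $b_a(\xi)=\sin(\theta_a(\xi-\pi))\cos(\theta_{2a}(\xi-2\pi))$ for $\xi\ge0$, and for $c\in\{a,2a\}$, $\theta_c(x)=\int_{-\infty}^x\phi_c(t)\,dt$ with some $0\le\phi_c\in\mathcal D_\sigma(\mathbb R)$ such that $\operatorname{supp}\phi_c\subset[-c,c]$ and $\int_{\mathbb R}\phi_c=\pi/2$. Then $\widehat\psi\in\mathcal D_\sigma(\mathbb R)$. (b) Suppose that $\widehat\psi\in\mathcal D_\sigma(\mathbb R)$ (in particular, suppose that $\widehat\psi$ is as in (a)). Then: (i) for every $n\in\mathbb N_0$ and every $h>0$ there is $C>0$ such that $$|\psi^{(n)}(x)|\le C\exp\Bigl(-h\Bigl(\tfrac{\ln^\sigma|x|}{W(\ln|x|)}\Bigr)^{1/(\sigma-1)}\Bigr)\qquad\text{for all sufficiently large }|x|;$$ (ii) for every $h>0$ there are $C>0$ and $R>0$ such that $$|\psi^{(n)}(x)|\le C^{n+1}\,n!^{\,s}\exp\Bigl(-h\Bigl(\tfrac{\ln^\sigma|x|}{W(\ln|x|)}\Bigr)^{1/(\sigma-1)}\Bigr)$$ for all $0<s\le1$,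 all $n\in\mathbb N_0$ and all $|x|\ge R$. -/

import Mathlib

open MeasureTheory Set
open scoped ContDiff FourierTransform

noncomputable section

/-! ### The Lambert function -/

/-- The (principal branch of the) Lambert function on `[0, ∞)`: the inverse there of
`w ↦ w * exp w`. -/
def lambertW : ℝ → ℝ :=
  Function.invFunOn (fun w : ℝ => w * Real.exp w) (Ici 0)

/-- `w ↦ w * exp w` maps `[0, ∞)` onto `[0, ∞)`, so that `lambertW` is a genuine inverse. -/
theorem lambertW_spec {x : ℝ} (hx : 0 ≤ x) :
    0 ≤ lambertW x ∧ lambertW x * Real.exp (lambertW x) = x := by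
  have h : ∃ w ∈ Ici (0 : ℝ), w * Real.exp w = x := by
    have hc : ContinuousOn (fun w : ℝ => w * Real.exp w) (Icc 0 x) := by fun_prop
    have hmem : x ∈ Icc ((fun w : ℝ => w * Real.exp w) 0) ((fun w : ℝ => w * Real.exp w) x) := by
      refine ⟨by simpa using hx, ?_⟩
      have : 1 ≤ Real.exp x := Real.one_le_exp hx
      simpa using mul_le_mul_of_nonneg_left this hx
    obtain ⟨w, hw, hwx⟩ := intermediate_value_Icc hx hc hmem
    exact ⟨w, hw.1, hwx⟩
  exact ⟨Function.invFunOn_mem h, Function.invFunOn_eq h⟩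

/-- The solution `w ≥ 0` of `w * exp w = x` is unique. -/
theorem lambertW_eq {w : ℝ} (hw : 0 ≤ w) : lambertW (w * Real.exp w) = w := by
  have hx : 0 ≤ w * Real.exp w := by positivity
  obtain ⟨h0, h1⟩ := lambertW_spec hx
  rcases lt_trichotomy (lambertW (w * Real.exp w)) w with h | h | h
  · have := mul_lt_mul'' h (Real.exp_lt_exp.2 h) h0 (Real.exp_pos _).le
    linarith
  · exact h
  · have := mul_lt_mul'' h (Real.exp_lt_exp.2 h) hw (Real.exp_pos _).le
    linarith

/-- `(ln^σ |x| / W(ln |x|))^{1/(σ-1)}`, meaningful for `|x| > 1`. -/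
def lambertRate (σ x : ℝ) : ℝ :=
  (Real.log |x| ^ σ / lambertW (Real.log |x|)) ^ (1 / (σ - 1))

/-! ### Extended Gevrey classes -/

/-- The defining sequence `M_p = p^{τ p^σ}`, `M_0 = 1`. -/
def extSeq (τ σ : ℝ) (p : ℕ) : ℝ := (p : ℝ) ^ (τ * (p : ℝ) ^ σ)

theorem extSeq_zero (τ : ℝ) {σ : ℝ} (hσ : σ ≠ 0) : extSeq τ σ 0 = 1 := by
  simp [extSeq, Real.zero_rpow hσ]

/-- The extended Gevrey class (of Roumieu type) of functions on `ℝ`: smooth functions such that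
on each compact set `K` one has `|φ^{(p)}| ≤ C h^{p^σ} M_p` for all `p`, for some `C, h > 0`. -/
def ExtGevrey {E : Type*} [NormedAddCommGroup E] [NormedSpace ℝ E] (τ σ : ℝ) : Set (ℝ → E) :=
  {φ | ContDiff ℝ ∞ φ ∧ ∀ K : Set ℝ, IsCompact K → ∃ C > 0, ∃ h > 0, ∀ p : ℕ, ∀ x ∈ K,
    ‖iteratedDeriv p φ x‖ ≤ C * h ^ ((p : ℝ) ^ σ) * extSeq τ σ p}

/-- The compactly supported functions in the extended Gevrey class. -/
def ExtGevreyC {E : Type*} [NormedAddCommGroup E] [NormedSpace ℝ E] (τ σ : ℝ) : Set (ℝ → E) :=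
  {φ | φ ∈ ExtGevrey τ σ ∧ HasCompactSupport φ}

/-- `D_σ(ℝ)`, the intersection of the classes of compactly supported functions over all `τ > 0`.
(The Beurling classes, with "for all `h` there is `C`", have the same intersection, because
`h^{p^σ} p^{τ p^σ} ≤ C p^{τ' p^σ}` for all `h > 0` and `τ < τ'`.) -/
def DSigma {E : Type*} [NormedAddCommGroup E] [NormedSpace ℝ E] (σ : ℝ) : Set (ℝ → E) :=
  ⋂ τ > (0 : ℝ), ExtGevreyC τ σ

/-! ### Orthonormal wavelets and their Fourier transforms -/

/-- `ψ_{m,n}(x) = 2^{m/2} ψ(2^m x - n)`. -/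
def waveletFun (ψ : ℝ → ℂ) (m n : ℤ) (x : ℝ) : ℂ :=
  (((2 : ℝ) ^ ((m : ℝ) / 2) : ℝ) : ℂ) * ψ ((2 : ℝ) ^ m * x - n)

/-- `ψ` is an orthonormal wavelet: the functions `ψ_{m,n}` form an orthonormal (Hilbert) basis
of `L²(ℝ)`. -/
def IsOrthonormalWavelet (ψ : ℝ → ℂ) : Prop :=
  ∃ b : HilbertBasis (ℤ × ℤ) ℂ (Lp ℂ 2 (volume : Measure ℝ)),
    ∀ m n : ℤ, (b (m, n) : ℝ → ℂ) =ᵐ[volume] waveletFun ψ m n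

/-- `g` is (a representative of) the `L²` Fourier transform of `f ∈ L²(ℝ)`, with the convention
`g(ξ) = ∫ f(x) e^{i x ξ} dx`. Mathlib's `𝓕` is `∫ f(x) e^{-2 π i x ξ} dx`, extended to `L²`, hence
`𝓕 f ξ = g (-2 π ξ)`. -/
def IsL2Fourier (f g : ℝ → ℂ) : Prop :=
  ∃ F : Lp ℂ 2 (volume : Measure ℝ), (F : ℝ → ℂ) =ᵐ[volume] f ∧
    ((𝓕 F : Lp ℂ 2 (volume : Measure ℝ)) : ℝ → ℂ) =ᵐ[volume] fun ξ => g (-(2 * Real.pi * ξ))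

/-! ### The band-limited wavelet -/

/-- A cutoff function: `φ ∈ D_σ(ℝ)`, `φ ≥ 0`, `supp φ ⊆ [-a, a]`, `∫ φ = π / 2`. -/
structure IsCutoff (σ a : ℝ) (φ : ℝ → ℝ) : Prop where
  mem : φ ∈ DSigma (E := ℝ) σ
  nonneg : ∀ x, 0 ≤ φ x
  supp : tsupport φ ⊆ Icc (-a) a
  integral : ∫ x, φ x = Real.pi / 2

/-- `θ(x) = ∫_{-∞}^x φ(t) dt`. -/
def primitive (φ : ℝ → ℝ) (x : ℝ) : ℝ := ∫ t in Iic x, φ t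

/-- The even bell function, equal to `sin (θ_a (x - π)) * cos (θ_{2a} (x - 2π))` for `x ≥ 0`,
where `θ_a`, `θ_{2a}` are the primitives of the cutoff functions `φ₁`, `φ₂`. -/
def bell (φ₁ φ₂ : ℝ → ℝ) (ξ : ℝ) : ℝ :=
  Real.sin (primitive φ₁ (|ξ| - Real.pi)) * Real.cos (primitive φ₂ (|ξ| - 2 * Real.pi))

/-- `g` has the form `g(ξ) = e^{i ξ / 2} b_a(ξ)`, `0 < a < π / 3`, with a bell function `b_a`
made of cutoff functions supported in `[-a, a]` and in `[-2a, 2a]`. -/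
def IsBellForm (σ : ℝ) (g : ℝ → ℂ) : Prop :=
  ∃ a : ℝ, 0 < a ∧ a < Real.pi / 3 ∧ ∃ φ₁ φ₂ : ℝ → ℝ,
    IsCutoff σ a φ₁ ∧ IsCutoff σ (2 * a) φ₂ ∧
    ∀ ξ : ℝ, g ξ = Complex.exp (Complex.I * (ξ / 2)) * (bell φ₁ φ₂ ξ : ℂ)

end

/-!
Both parts rest on one observation: since `σ > 1`, the weights `p ^ (τ * p ^ σ)` grow so fast that,
at the price of an arbitrarily small increase of `τ`, they absorb the factors `h ^ (p ^ σ)`, `c ^ p`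
and `p!` (`rpow_rpow_le_extSeq`, `pow_mul_factorial_le_extSeq`). As membership in `DSigma` concerns
all `τ > 0`, such factors never matter.

For the bell function, `ξ ↦ exp (i θ ξ)` with `θ' ∈ DSigma` solves the linear equation
`f' = i θ' f`. Leibniz' rule and the supermultiplicativity of the weights (`extSeq_mul_le`) bound
`f^{(p)}` by `B ^ p * p!` times the weight (`UnifExtGevrey.of_hasDerivAt_mul`), so that no formula
for higher derivatives of compositions is needed. The bell function is a combination of translates,
reflections and products of such phases, and has compact support.

For the decay, Fourier inversion (`IsL2Fourier.eq_fourier`) writes `ψ` as the Fourier transform of a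
rescaling of its own transform, which has compact support. Integration by parts then gives
`|x| ^ p * ‖ψ^{(n)} x‖ ≤ C ^ (n + 1) * p ^ (τ * p ^ σ)` for all `n` and `p`
(`pow_mul_iteratedDeriv_fourier_le`). With `w = W (log |x|)`, that is `log |x| = w * exp w`, the
choice `p ≈ K * exp (w / (σ - 1))` makes `p * log |x|` and `p ^ σ * log p` both comparable to
`w * exp (σ * w / (σ - 1))`, which is exactly the rate `(log ^ σ |x| / w) ^ (1 / (σ - 1))`; a small
`τ` makes the first one win by the prescribed factor `h` (`exists_extSeq_le_pow_mul_exp`). The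
constant is geometric in `n`, so both decay estimates follow, as `n! ^ s ≥ 1`.
-/

/-! ### The weights `p ^ (τ * p ^ σ)` -/

theorem extSeq_eq_exp {τ σ : ℝ} (hσ : σ ≠ 0) (p : ℕ) :
    extSeq τ σ p = Real.exp (τ * ((p : ℝ) ^ σ * Real.log p)) := by
  rcases Nat.eq_zero_or_pos p with rfl | hp
  · simp [extSeq_zero τ hσ]
  · rw [extSeq, Real.rpow_def_of_pos (by exact_mod_cast hp)]
    ring_nf

theorem extSeq_pos {τ σ : ℝ} (hσ : σ ≠ 0) (p : ℕ) : 0 < extSeq τ σ p := by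
  rw [extSeq_eq_exp hσ]
  exact Real.exp_pos _

theorem extSeq_mul_extSeq {τ τ' σ : ℝ} (hσ : σ ≠ 0) (p : ℕ) :
    extSeq τ σ p * extSeq τ' σ p = extSeq (τ + τ') σ p := by
  rw [extSeq_eq_exp hσ, extSeq_eq_exp hσ, extSeq_eq_exp hσ, ← Real.exp_add]
  ring_nf

/-- `p ↦ p ^ σ * log p` is nondecreasing, with the value `0` at `p = 0`. -/
theorem extSeq_mono {τ σ : ℝ} (hσ : 0 < σ) (hτ : 0 ≤ τ) : Monotone (extSeq τ σ) := by
  intro p q hpq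
  rw [extSeq_eq_exp hσ.ne', extSeq_eq_exp hσ.ne']
  refine Real.exp_le_exp.2 (mul_le_mul_of_nonneg_left ?_ hτ)
  rcases Nat.eq_zero_or_pos p with rfl | hp
  · simp only [Nat.cast_zero, Real.log_zero, mul_zero]
    exact mul_nonneg (by positivity) (Real.log_natCast_nonneg q)
  · exact mul_le_mul (Real.rpow_le_rpow (by positivity) (by exact_mod_cast hpq) hσ.le)
      (Real.log_le_log (by exact_mod_cast hp) (by exact_mod_cast hpq))
      (Real.log_natCast_nonneg p) (by positivity)

/-- Supermultiplicativity of the weights, which comes from the superadditivity of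
`p ↦ p ^ σ * log p`. -/
theorem extSeq_mul_le {τ σ : ℝ} (hσ : 1 ≤ σ) (hτ : 0 ≤ τ) (a b : ℕ) :
    extSeq τ σ a * extSeq τ σ b ≤ extSeq τ σ (a + b) := by
  have hσ0 : σ ≠ 0 := by linarith
  rw [extSeq_eq_exp hσ0, extSeq_eq_exp hσ0, extSeq_eq_exp hσ0, ← Real.exp_add, ← mul_add]
  refine Real.exp_le_exp.2 (mul_le_mul_of_nonneg_left ?_ hτ)
  have key : ∀ c d : ℕ, Real.log c ≤ Real.log ((c + d : ℕ) : ℝ) := by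
    intro c d
    rcases Nat.eq_zero_or_pos c with rfl | hc
    · simpa using Real.log_natCast_nonneg d
    · exact Real.log_le_log (by exact_mod_cast hc) (by exact_mod_cast Nat.le_add_right c d)
  have h1 := key a b
  have h2 := key b a
  rw [add_comm b a] at h2
  have h3 : (a : ℝ) ^ σ + (b : ℝ) ^ σ ≤ ((a + b : ℕ) : ℝ) ^ σ := by
    push_cast
    exact Real.add_rpow_le_rpow_add (by positivity) (by positivity) hσ
  calc (a : ℝ) ^ σ * Real.log a + (b : ℝ) ^ σ * Real.log b
      ≤ (a : ℝ) ^ σ * Real.log ((a + b : ℕ) : ℝ) + (b : ℝ) ^ σ * Real.log ((a + b : ℕ) : ℝ) := by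
        gcongr
    _ = ((a : ℝ) ^ σ + (b : ℝ) ^ σ) * Real.log ((a + b : ℕ) : ℝ) := by ring
    _ ≤ ((a + b : ℕ) : ℝ) ^ σ * Real.log ((a + b : ℕ) : ℝ) :=
        mul_le_mul_of_nonneg_right h3 (Real.log_natCast_nonneg _)

theorem exists_bound_of_eventually_le {f g : ℕ → ℝ} (hf : ∀ p, 0 ≤ f p) (hg : ∀ p, 0 < g p)
    (h : ∀ᶠ p in Filter.atTop, f p ≤ g p) : ∃ C > 0, ∀ p, f p ≤ C * g p := by
  have hO : f =O[Filter.atTop] g := by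
    refine Asymptotics.IsBigO.of_bound 1 (h.mono fun p hp => ?_)
    rw [Real.norm_of_nonneg (hf p), Real.norm_of_nonneg (hg p).le, one_mul]
    exact hp
  obtain ⟨C, hC, hb⟩ := Asymptotics.bound_of_isBigO_nat_atTop hO
  refine ⟨C, hC, fun p => ?_⟩
  have := hb (hg p).ne'
  rwa [Real.norm_of_nonneg (hf p), Real.norm_of_nonneg (hg p).le] at this

theorem rpow_rpow_le_extSeq {σ h ε : ℝ} (hσ : σ ≠ 0) (hh : 0 < h) (hε : 0 < ε) :
    ∃ C > 0, ∀ p : ℕ, h ^ ((p : ℝ) ^ σ) ≤ C * extSeq ε σ p := by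
  refine exists_bound_of_eventually_le (fun p => by positivity) (extSeq_pos hσ) ?_
  have hlim : Filter.Tendsto (fun p : ℕ => ε * Real.log p) Filter.atTop Filter.atTop :=
    (Real.tendsto_log_atTop.comp tendsto_natCast_atTop_atTop).const_mul_atTop hε
  filter_upwards [hlim.eventually_ge_atTop (Real.log h)] with p hp
  rw [extSeq_eq_exp hσ, Real.rpow_def_of_pos hh]
  refine Real.exp_le_exp.2 ?_
  have : (0 : ℝ) ≤ (p : ℝ) ^ σ := by positivity
  nlinarith

/-- Geometric and factorial growth are absorbed by `p ^ (ε * p ^ σ)` since `σ > 1`. -/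
theorem pow_mul_factorial_le_extSeq {σ c ε : ℝ} (hσ : 1 < σ) (hc : 0 ≤ c) (hε : 0 < ε) :
    ∃ C > 0, ∀ p : ℕ, c ^ p * (p.factorial : ℝ) ≤ C * extSeq ε σ p := by
  have hσ0 : σ ≠ 0 := by linarith
  refine exists_bound_of_eventually_le (fun p => by positivity) (extSeq_pos hσ0) ?_
  have hlim : Filter.Tendsto (fun p : ℕ => ε * (p : ℝ) ^ (σ - 1)) Filter.atTop Filter.atTop :=
    ((tendsto_rpow_atTop (sub_pos.2 hσ)).comp tendsto_natCast_atTop_atTop).const_mul_atTop hε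
  filter_upwards [hlim.eventually_ge_atTop 2, Filter.eventually_gt_atTop 0,
    tendsto_natCast_atTop_atTop.eventually_ge_atTop c] with p h2 hp hcp
  have hp' : (0 : ℝ) < p := by exact_mod_cast hp
  have hfac : (p.factorial : ℝ) ≤ (p : ℝ) ^ p := by exact_mod_cast Nat.factorial_le_pow p
  have hsplit : (p : ℝ) ^ σ = p ^ (σ - 1) * p := by
    rw [← Real.rpow_add_one hp'.ne']
    ring_nf
  calc c ^ p * (p.factorial : ℝ) ≤ (p : ℝ) ^ p * (p : ℝ) ^ p := by gcongr
    _ = Real.exp (2 * p * Real.log p) := by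
        rw [← pow_add, ← Real.rpow_natCast, Real.rpow_def_of_pos hp']
        push_cast
        ring_nf
    _ ≤ extSeq ε σ p := by
        rw [extSeq_eq_exp hσ0]
        refine Real.exp_le_exp.2 ?_
        have h0 : 0 ≤ (p : ℝ) * Real.log p := mul_nonneg hp'.le (Real.log_natCast_nonneg p)
        calc 2 * (p : ℝ) * Real.log p = 2 * (p * Real.log p) := by ring
          _ ≤ ε * (p : ℝ) ^ (σ - 1) * (p * Real.log p) := mul_le_mul_of_nonneg_right h2 h0
          _ = ε * ((p : ℝ) ^ σ * Real.log p) := by rw [hsplit]; ring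

/-! ### Globally bounded extended Gevrey functions -/

/-- Smooth functions all of whose derivatives obey, uniformly on `ℝ`, the bounds
`‖f^{(p)}‖ ≤ C * p ^ (τ * p ^ σ)` for each `τ > 0`. No factor `h ^ (p ^ σ)` is needed, since it is
absorbed by a change of `τ`. For compactly supported functions this is membership in `DSigma`. -/
def UnifExtGevrey {E : Type*} [NormedAddCommGroup E] [NormedSpace ℝ E] (σ : ℝ) : Set (ℝ → E) :=
  {f | ContDiff ℝ ∞ f ∧ ∀ τ > 0, ∃ C > 0, ∀ (p : ℕ) (x : ℝ),
    ‖iteratedDeriv p f x‖ ≤ C * extSeq τ σ p}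

section Normed

variable {E : Type*} [NormedAddCommGroup E] [NormedSpace ℝ E] {σ : ℝ}

theorem hasCompactSupport_of_mem_DSigma {f : ℝ → E} (hf : f ∈ DSigma σ) :
    HasCompactSupport f :=
  (mem_iInter₂.1 hf 1 one_pos).2

theorem unifExtGevrey_of_mem_DSigma {f : ℝ → E} (hσ : σ ≠ 0) (hf : f ∈ DSigma σ) :
    f ∈ UnifExtGevrey σ := by
  refine ⟨(mem_iInter₂.1 hf 1 one_pos).1.1, fun τ hτ => ?_⟩
  obtain ⟨⟨-, hb⟩, hcs⟩ := mem_iInter₂.1 hf (τ / 2) (half_pos hτ)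
  obtain ⟨C, hC, h, hh, hb⟩ := hb (tsupport f) hcs
  obtain ⟨D, hD, hhD⟩ := rpow_rpow_le_extSeq hσ hh (half_pos hτ)
  refine ⟨C * D, by positivity, fun p x => ?_⟩
  have hpos := extSeq_pos (τ := τ / 2) hσ p
  by_cases hx : x ∈ tsupport f
  · calc ‖iteratedDeriv p f x‖ ≤ C * h ^ ((p : ℝ) ^ σ) * extSeq (τ / 2) σ p := hb p x hx
      _ ≤ C * (D * extSeq (τ / 2) σ p) * extSeq (τ / 2) σ p := by
          gcongr
          exact hhD p
      _ = C * D * (extSeq (τ / 2) σ p * extSeq (τ / 2) σ p) := by ring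
      _ = C * D * extSeq τ σ p := by rw [extSeq_mul_extSeq hσ, add_halves]
  · have h0 : iteratedFDeriv ℝ p f x = 0 := by
      by_contra hne
      exact hx (support_iteratedFDeriv_subset p hne)
    rw [← norm_iteratedFDeriv_eq_norm_iteratedDeriv, h0, norm_zero]
    have := extSeq_pos (τ := τ) hσ p
    positivity

theorem mem_DSigma_of_unifExtGevrey {f : ℝ → E} (hf : f ∈ UnifExtGevrey σ)
    (hcs : HasCompactSupport f) : f ∈ DSigma σ := by
  refine mem_iInter₂.2 fun τ hτ => ⟨⟨hf.1, fun K _ => ?_⟩, hcs⟩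
  obtain ⟨C, hC, hb⟩ := hf.2 τ hτ
  refine ⟨C, hC, 1, one_pos, fun p x _ => ?_⟩
  rw [Real.one_rpow, mul_one]
  exact hb p x

namespace UnifExtGevrey

theorem add {f g : ℝ → E} (hf : f ∈ UnifExtGevrey σ) (hg : g ∈ UnifExtGevrey σ) :
    (fun x => f x + g x) ∈ UnifExtGevrey σ := by
  refine ⟨hf.1.add hg.1, fun τ hτ => ?_⟩
  obtain ⟨A, hA, hfb⟩ := hf.2 τ hτ
  obtain ⟨B, hB, hgb⟩ := hg.2 τ hτ
  refine ⟨A + B, by positivity, fun p x => ?_⟩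
  have hadd : iteratedDeriv p (fun x => f x + g x) x = iteratedDeriv p f x + iteratedDeriv p g x :=
    iteratedDeriv_fun_add (hf.1.contDiffAt.of_le (mod_cast le_top))
      (hg.1.contDiffAt.of_le (mod_cast le_top))
  rw [hadd, add_mul]
  exact norm_add_le_of_le (hfb p x) (hgb p x)

theorem comp_sub_const {f : ℝ → E} (hf : f ∈ UnifExtGevrey σ) (s : ℝ) :
    (fun x => f (x - s)) ∈ UnifExtGevrey σ := by
  refine ⟨hf.1.comp (by fun_prop), fun τ hτ => ?_⟩
  obtain ⟨A, hA, hfb⟩ := hf.2 τ hτ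
  refine ⟨A, hA, fun p x => ?_⟩
  rw [iteratedDeriv_comp_sub_const]
  exact hfb p _

theorem comp_neg {f : ℝ → E} (hf : f ∈ UnifExtGevrey σ) :
    (fun x => f (-x)) ∈ UnifExtGevrey σ := by
  refine ⟨hf.1.comp (by fun_prop), fun τ hτ => ?_⟩
  obtain ⟨A, hA, hfb⟩ := hf.2 τ hτ
  refine ⟨A, hA, fun p x => ?_⟩
  rw [iteratedDeriv_comp_neg, norm_smul, norm_pow, norm_neg, norm_one, one_pow, one_mul]
  exact hfb p _

theorem comp_const_mul {f : ℝ → E} (hσ : 1 < σ) (hf : f ∈ UnifExtGevrey σ) (c : ℝ) :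
    (fun x => f (c * x)) ∈ UnifExtGevrey σ := by
  have hσ0 : σ ≠ 0 := by linarith
  refine ⟨hf.1.comp (by fun_prop), fun τ hτ => ?_⟩
  obtain ⟨A, hA, hfb⟩ := hf.2 _ (half_pos hτ)
  obtain ⟨D, hD, hDb⟩ := pow_mul_factorial_le_extSeq hσ (abs_nonneg c) (half_pos hτ)
  refine ⟨D * A, by positivity, fun p x => ?_⟩
  have hpos := extSeq_pos (τ := τ / 2) hσ0 p
  rw [iteratedDeriv_comp_const_smul (hf.1.of_le (by exact_mod_cast le_top)), norm_smul, norm_pow,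
    Real.norm_eq_abs]
  have h1 : (1 : ℝ) ≤ p.factorial := by exact_mod_cast p.factorial_pos
  calc |c| ^ p * ‖iteratedDeriv p f (c * x)‖
      ≤ |c| ^ p * p.factorial * (A * extSeq (τ / 2) σ p) := by
        refine mul_le_mul ?_ (hfb p _) (norm_nonneg _) (by positivity)
        exact le_mul_of_one_le_right (by positivity) h1
    _ ≤ D * extSeq (τ / 2) σ p * (A * extSeq (τ / 2) σ p) :=
        mul_le_mul_of_nonneg_right (hDb p) (by positivity)
    _ = D * A * (extSeq (τ / 2) σ p * extSeq (τ / 2) σ p) := by ring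
    _ = D * A * extSeq τ σ p := by rw [extSeq_mul_extSeq hσ0, add_halves]

theorem const (hσ : σ ≠ 0) (c : E) : (fun _ : ℝ => c) ∈ UnifExtGevrey σ := by
  refine ⟨contDiff_const, fun τ hτ => ⟨‖c‖ + 1, by positivity, fun p x => ?_⟩⟩
  have hpos := extSeq_pos (τ := τ) hσ p
  rw [iteratedDeriv_const]
  split_ifs with hp
  · rw [hp, extSeq_zero τ hσ]
    linarith
  · rw [norm_zero]
    positivity

theorem ofReal {f : ℝ → ℝ} (hf : f ∈ UnifExtGevrey σ) :
    (fun x => (f x : ℂ)) ∈ UnifExtGevrey σ := by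
  refine ⟨Complex.ofRealCLM.contDiff.comp hf.1, fun τ hτ => ?_⟩
  obtain ⟨A, hA, hfb⟩ := hf.2 τ hτ
  refine ⟨A, hA, fun p x => ?_⟩
  have := Complex.ofRealLI.norm_iteratedFDeriv_comp_left (i := p) (x := x) hf.1.contDiffAt
    (by exact_mod_cast le_top)
  rw [norm_iteratedFDeriv_eq_norm_iteratedDeriv, norm_iteratedFDeriv_eq_norm_iteratedDeriv] at this
  exact this.trans_le (hfb p x)

end UnifExtGevrey

end Normed

namespace UnifExtGevrey

variable {σ : ℝ}

theorem mul {f g : ℝ → ℂ} (hσ : 1 < σ) (hf : f ∈ UnifExtGevrey σ) (hg : g ∈ UnifExtGevrey σ) :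
    (fun x => f x * g x) ∈ UnifExtGevrey σ := by
  have hσ0 : σ ≠ 0 := by linarith
  refine ⟨hf.1.mul hg.1, fun τ hτ => ?_⟩
  obtain ⟨A, hA, hfb⟩ := hf.2 _ (half_pos hτ)
  obtain ⟨B, hB, hgb⟩ := hg.2 _ (half_pos hτ)
  obtain ⟨D, hD, hDb⟩ := pow_mul_factorial_le_extSeq (c := 2) hσ (by norm_num) (half_pos hτ)
  refine ⟨A * B * D, by positivity, fun p x => ?_⟩
  have hpos := extSeq_pos (τ := τ / 2) hσ0
  have hL := norm_iteratedFDeriv_mul_le hf.1 hg.1 x (n := p) (by exact_mod_cast le_top)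
  simp only [norm_iteratedFDeriv_eq_norm_iteratedDeriv] at hL
  calc ‖iteratedDeriv p (fun x => f x * g x) x‖
      ≤ ∑ i ∈ Finset.range (p + 1),
          (p.choose i : ℝ) * ‖iteratedDeriv i f x‖ * ‖iteratedDeriv (p - i) g x‖ := hL
    _ ≤ ∑ i ∈ Finset.range (p + 1), (p.choose i : ℝ) * (A * B * extSeq (τ / 2) σ p) := by
        refine Finset.sum_le_sum fun i hi => ?_
        have hi' : i + (p - i) = p := by have := Finset.mem_range.1 hi; omega
        have hm := extSeq_mul_le hσ.le (half_pos hτ).le i (p - i)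
        rw [hi'] at hm
        have := hpos i
        calc (p.choose i : ℝ) * ‖iteratedDeriv i f x‖ * ‖iteratedDeriv (p - i) g x‖
            ≤ (p.choose i : ℝ) * (A * extSeq (τ / 2) σ i) * (B * extSeq (τ / 2) σ (p - i)) := by
              gcongr
              · exact hfb i x
              · exact hgb (p - i) x
          _ = (p.choose i : ℝ) * (A * B * (extSeq (τ / 2) σ i * extSeq (τ / 2) σ (p - i))) := by
              ring
          _ ≤ (p.choose i : ℝ) * (A * B * extSeq (τ / 2) σ p) := by gcongr
    _ = A * B * (2 ^ p * 1) * extSeq (τ / 2) σ p := by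
        rw [← Finset.sum_mul]
        have : ∑ i ∈ Finset.range (p + 1), (p.choose i : ℝ) = 2 ^ p := by
          exact_mod_cast Nat.sum_range_choose p
        rw [this]
        ring
    _ ≤ A * B * (2 ^ p * (p.factorial : ℝ)) * extSeq (τ / 2) σ p := by
        have h1 : (1 : ℝ) ≤ p.factorial := by exact_mod_cast p.factorial_pos
        have := hpos p
        gcongr
    _ ≤ A * B * (D * extSeq (τ / 2) σ p) * extSeq (τ / 2) σ p := by
        refine mul_le_mul_of_nonneg_right ?_ (hpos p).le
        exact mul_le_mul_of_nonneg_left (hDb p) (by positivity)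
    _ = A * B * D * (extSeq (τ / 2) σ p * extSeq (τ / 2) σ p) := by ring
    _ = A * B * D * extSeq τ σ p := by rw [extSeq_mul_extSeq hσ0, add_halves]

/-- Bounded solutions of a linear equation `f' = u f` with extended Gevrey coefficient `u` are
extended Gevrey. Applied to `f = exp ∘ v`, `u = v'`, this replaces the Faà di Bruno formula: Leibniz'
rule and induction on the order give `‖f^{(p)}‖ ≤ B ^ p * p! * p ^ (τ * p ^ σ)`. -/
theorem of_hasDerivAt_mul {u f : ℝ → ℂ} (hσ : 1 < σ) (hu : u ∈ UnifExtGevrey σ)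
    (hd : ∀ x, HasDerivAt f (u x * f x) x) (hf1 : ∀ x, ‖f x‖ ≤ 1) : f ∈ UnifExtGevrey σ := by
  have hσ0 : σ ≠ 0 := by linarith
  have hderiv : deriv f = fun x => u x * f x := funext fun x => (hd x).deriv
  have hsm : ContDiff ℝ ∞ f := by
    refine contDiff_infty.2 fun n => ?_
    induction n with
    | zero =>
      exact contDiff_zero.2 (continuous_iff_continuousAt.2 fun x => (hd x).continuousAt)
    | succ n ih =>
      push_cast
      refine contDiff_succ_iff_deriv.2 ⟨fun x => (hd x).differentiableAt, by simp, ?_⟩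
      rw [hderiv]
      exact (hu.1.of_le (by exact_mod_cast le_top)).mul ih
  refine ⟨hsm, fun τ hτ => ?_⟩
  have hτ2 := half_pos hτ
  obtain ⟨C, hC, hub⟩ := hu.2 _ hτ2
  have hpos := extSeq_pos (τ := τ / 2) hσ0
  set B := C + 1 with hB
  have hB0 : 0 < B := by positivity
  have hB1 : 1 ≤ B := by linarith
  have key : ∀ p : ℕ, ∀ x, ‖iteratedDeriv p f x‖ ≤ B ^ p * p.factorial * extSeq (τ / 2) σ p := by
    intro p
    induction p using Nat.strong_induction_on with
    | _ p ih =>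
      intro x
      rcases p with _ | p
      · simpa [extSeq_zero _ hσ0] using hf1 x
      rw [iteratedDeriv_succ', hderiv]
      have hL := norm_iteratedFDeriv_mul_le hu.1 hsm x (n := p) (by exact_mod_cast le_top)
      simp only [norm_iteratedFDeriv_eq_norm_iteratedDeriv] at hL
      calc ‖iteratedDeriv p (fun x => u x * f x) x‖
          ≤ ∑ i ∈ Finset.range (p + 1),
              (p.choose i : ℝ) * ‖iteratedDeriv i u x‖ * ‖iteratedDeriv (p - i) f x‖ := hL
        _ ≤ ∑ i ∈ Finset.range (p + 1), B ^ (p + 1) * p.factorial * extSeq (τ / 2) σ (p + 1) := by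
            refine Finset.sum_le_sum fun i hi => ?_
            have hip : i ≤ p := by have := Finset.mem_range.1 hi; omega
            have hi' : i + (p - i) = p := by omega
            have hm := extSeq_mul_le hσ.le hτ2.le i (p - i)
            rw [hi'] at hm
            have hm' := hm.trans (extSeq_mono (by linarith) hτ2.le p.le_succ)
            have hch : (p.choose i : ℝ) * (p - i).factorial ≤ p.factorial := by
              have h1 := Nat.choose_mul_factorial_mul_factorial hip
              have h2 : p.choose i * (p - i).factorial ≤ p.factorial := by
                calc p.choose i * (p - i).factorial
                    ≤ p.choose i * i.factorial * (p - i).factorial := by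
                      gcongr
                      exact Nat.le_mul_of_pos_right _ i.factorial_pos
                  _ = p.factorial := h1
              exact_mod_cast h2
            have hpi := hpos i
            have hppi := hpos (p - i)
            calc (p.choose i : ℝ) * ‖iteratedDeriv i u x‖ * ‖iteratedDeriv (p - i) f x‖
                ≤ (p.choose i : ℝ) * (B * extSeq (τ / 2) σ i) *
                    (B ^ p * (p - i).factorial * extSeq (τ / 2) σ (p - i)) := by
                  gcongr
                  · exact (hub i x).trans (by gcongr; linarith)
                  · refine (ih (p - i) (by omega) x).trans ?_
                    gcongr
                    exact p.sub_le i
              _ = B ^ (p + 1) * ((p.choose i : ℝ) * (p - i).factorial) *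
                    (extSeq (τ / 2) σ i * extSeq (τ / 2) σ (p - i)) := by ring
              _ ≤ B ^ (p + 1) * p.factorial * extSeq (τ / 2) σ (p + 1) := by gcongr
        _ = B ^ (p + 1) * (p + 1).factorial * extSeq (τ / 2) σ (p + 1) := by
            rw [Finset.sum_const, Finset.card_range, nsmul_eq_mul, Nat.factorial_succ]
            push_cast
            ring
  obtain ⟨D, hD, hDb⟩ := pow_mul_factorial_le_extSeq hσ hB0.le hτ2
  refine ⟨D, hD, fun p x => (key p x).trans ?_⟩
  calc B ^ p * p.factorial * extSeq (τ / 2) σ p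
      ≤ D * extSeq (τ / 2) σ p * extSeq (τ / 2) σ p :=
        mul_le_mul_of_nonneg_right (hDb p) (hpos p).le
    _ = D * extSeq τ σ p := by rw [mul_assoc, extSeq_mul_extSeq hσ0, add_halves]

/-- Phases: `exp (i θ)` is extended Gevrey if the derivative of the real function `θ` is. -/
theorem exp_I_mul {θ θ' : ℝ → ℝ} (hσ : 1 < σ) (hθ : ∀ x, HasDerivAt θ (θ' x) x)
    (hθ' : θ' ∈ UnifExtGevrey σ) (s : ℝ) :
    (fun x => Complex.exp (Complex.I * (s * θ x : ℝ))) ∈ UnifExtGevrey σ := by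
  have hσ0 : σ ≠ 0 := by linarith
  refine of_hasDerivAt_mul (u := fun x => Complex.I * s * (θ' x : ℂ)) hσ
    (mul hσ (const hσ0 _) (ofReal hθ')) (fun x => ?_) (fun x => ?_)
  · have h := ((((hθ x).const_mul s).ofReal_comp).const_mul Complex.I).cexp
    convert h using 1
    push_cast
    ring
  · rw [mul_comm, Complex.norm_exp_ofReal_mul_I]

theorem sin_cos {θ θ' : ℝ → ℝ} (hσ : 1 < σ) (hθ : ∀ x, HasDerivAt θ (θ' x) x)
    (hθ' : θ' ∈ UnifExtGevrey σ) :
    (fun x => (Real.sin (θ x) : ℂ)) ∈ UnifExtGevrey σ ∧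
      (fun x => (Real.cos (θ x) : ℂ)) ∈ UnifExtGevrey σ := by
  have hσ0 : σ ≠ 0 := by linarith
  have h1 := exp_I_mul hσ hθ hθ' 1
  have h2 := exp_I_mul hσ hθ hθ' (-1)
  constructor
  · convert mul hσ (const hσ0 (Complex.I / 2)) (add h2 (mul hσ (const hσ0 (-1)) h1)) using 2 with x
    rw [Complex.ofReal_sin, Complex.sin]
    push_cast
    ring_nf
  · convert mul hσ (const hσ0 (1 / 2)) (add h1 h2) using 2 with x
    rw [Complex.ofReal_cos, Complex.cos]
    push_cast
    ring_nf

end UnifExtGevrey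

/-! ### The bell function -/

namespace IsCutoff

variable {σ a : ℝ} {φ : ℝ → ℝ}

theorem integrable (h : IsCutoff σ a φ) : Integrable φ :=
  (mem_iInter₂.1 h.mem 1 one_pos).1.1.continuous.integrable_of_hasCompactSupport
    (hasCompactSupport_of_mem_DSigma h.mem)

theorem eq_zero (h : IsCutoff σ a φ) {x : ℝ} (hx : x ∉ Icc (-a) a) : φ x = 0 :=
  image_eq_zero_of_notMem_tsupport fun hx' => hx (h.supp hx')

theorem hasDerivAt_primitive (h : IsCutoff σ a φ) (x : ℝ) :
    HasDerivAt (primitive φ) (φ x) x := by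
  have hc : Continuous φ := (mem_iInter₂.1 h.mem 1 one_pos).1.1.continuous
  have heq : primitive φ = fun y => primitive φ 0 + ∫ t in (0 : ℝ)..y, φ t := by
    funext y
    rw [primitive, primitive,
      ← intervalIntegral.integral_Iic_sub_Iic h.integrable.integrableOn h.integrable.integrableOn]
    ring
  rw [heq]
  exact (intervalIntegral.integral_hasDerivAt_right (hc.intervalIntegrable _ _)
    (hc.stronglyMeasurableAtFilter _ _) hc.continuousAt).const_add _

theorem primitive_eq_zero (h : IsCutoff σ a φ) {x : ℝ} (hx : x < -a) : primitive φ x = 0 :=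
  setIntegral_eq_zero_of_forall_eq_zero fun t ht =>
    h.eq_zero fun ht' => absurd ht'.1 (by have : t ≤ x := ht; linarith)

theorem primitive_eq_pi_div_two (h : IsCutoff σ a φ) {x : ℝ} (hx : a ≤ x) :
    primitive φ x = Real.pi / 2 := by
  rw [primitive, setIntegral_eq_integral_of_forall_compl_eq_zero, h.integral]
  intro t ht
  refine h.eq_zero fun ht' => ht ?_
  have := ht'.2
  simp only [mem_Iic]
  linarith

theorem unifExtGevrey_sin_cos_primitive (hσ : 1 < σ) (h : IsCutoff σ a φ) :
    (fun x => (Real.sin (primitive φ x) : ℂ)) ∈ UnifExtGevrey σ ∧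
      (fun x => (Real.cos (primitive φ x) : ℂ)) ∈ UnifExtGevrey σ :=
  UnifExtGevrey.sin_cos hσ h.hasDerivAt_primitive
    (unifExtGevrey_of_mem_DSigma (by linarith) h.mem)

end IsCutoff

theorem IsBellForm.mem_DSigma {σ : ℝ} (hσ : 1 < σ) {g : ℝ → ℂ} (hg : IsBellForm σ g) :
    g ∈ DSigma (E := ℂ) σ := by
  obtain ⟨a, ha0, ha, φ₁, φ₂, h₁, h₂, hgeq⟩ := hg
  have hpi := Real.pi_pos
  set b : ℝ → ℂ := fun ξ => (Real.sin (primitive φ₁ (ξ - Real.pi)) : ℂ) *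
    (Real.cos (primitive φ₂ (ξ - 2 * Real.pi)) : ℂ) with hb
  have hbm : b ∈ UnifExtGevrey σ :=
    UnifExtGevrey.mul hσ
      (UnifExtGevrey.comp_sub_const (h₁.unifExtGevrey_sin_cos_primitive hσ).1 Real.pi)
      (UnifExtGevrey.comp_sub_const (h₂.unifExtGevrey_sin_cos_primitive hσ).2 (2 * Real.pi))
  have hb0 : ∀ ξ ≤ 0, b ξ = 0 := by
    intro ξ hξ
    simp [hb, h₁.primitive_eq_zero (show ξ - Real.pi < -a by linarith)]
  -- Since `a < π`, the bell function vanishes near `0`, so `|ξ|` causes no loss of smoothness.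
  have hbell : ∀ ξ, (bell φ₁ φ₂ ξ : ℂ) = b ξ + b (-ξ) := by
    intro ξ
    rcases le_total 0 ξ with h | h
    · rw [hb0 (-ξ) (by linarith), add_zero, bell, abs_of_nonneg h, Complex.ofReal_mul]
    · rw [hb0 ξ h, zero_add, bell, abs_of_nonpos h, Complex.ofReal_mul]
  have hgeq' : g = fun ξ => Complex.exp (Complex.I * ((1 / 2 : ℝ) * ξ : ℝ)) * (b ξ + b (-ξ)) := by
    funext ξ
    rw [hgeq, hbell]
    congr 3
    push_cast
    ring
  refine mem_DSigma_of_unifExtGevrey ?_ ?_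
  · rw [hgeq']
    exact UnifExtGevrey.mul hσ
      (UnifExtGevrey.exp_I_mul hσ hasDerivAt_id (UnifExtGevrey.const (by linarith) 1) (1 / 2))
      (UnifExtGevrey.add hbm (UnifExtGevrey.comp_neg hbm))
  · refine HasCompactSupport.intro (isCompact_Icc (a := -(2 * a + 2 * Real.pi))
      (b := 2 * a + 2 * Real.pi)) fun ξ hξ => ?_
    have hξ' : 2 * a + 2 * Real.pi ≤ |ξ| := by
      by_contra! hlt
      exact hξ (abs_le.1 hlt.le)
    rw [hgeq, bell, h₂.primitive_eq_pi_div_two (show 2 * a ≤ |ξ| - 2 * Real.pi by linarith)]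
    simp

/-! ### Optimization of the decay estimate -/

theorem lambertW_mono {x y : ℝ} (hx : 0 ≤ x) (hxy : x ≤ y) : lambertW x ≤ lambertW y := by
  obtain ⟨h0, h1⟩ := lambertW_spec hx
  obtain ⟨h0', h1'⟩ := lambertW_spec (hx.trans hxy)
  by_contra! h
  have := mul_lt_mul'' h (Real.exp_lt_exp.2 h) h0' (Real.exp_pos _).le
  linarith

/-- In terms of `w = lambertW (log |x|)` one has `log |x| = w * exp w`, and the rate becomes
`w * exp (σ * w / (σ - 1))`. -/
theorem lambertRate_eq {σ x : ℝ} (hσ : 1 < σ) (hw : 0 < lambertW (Real.log |x|))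
    (hx : 0 ≤ Real.log |x|) :
    lambertRate σ x =
      lambertW (Real.log |x|) * Real.exp (σ * (lambertW (Real.log |x|) / (σ - 1))) := by
  have hs : σ - 1 ≠ 0 := by linarith
  have hs' : σ + -1 ≠ 0 := by linarith
  rw [lambertRate]
  obtain ⟨-, h⟩ := lambertW_spec hx
  set w := lambertW (Real.log |x|)
  rw [← h, Real.mul_rpow hw.le (Real.exp_pos _).le, ← Real.exp_mul]
  have : w ^ σ * Real.exp (w * σ) / w = w ^ (σ - 1) * Real.exp (w * σ) := by
    rw [Real.rpow_sub_one hw.ne']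
    ring
  rw [this, Real.mul_rpow (by positivity) (Real.exp_pos _).le, ← Real.rpow_mul hw.le,
    ← Real.exp_mul, mul_one_div_cancel hs, Real.rpow_one]
  congr 2
  field_simp

/-- The choice `p ≈ K * exp (w / (σ - 1))`, `w = lambertW (log |x|)`, in the bounds
`extSeq τ σ p / |x| ^ p`, for `τ` small in terms of `σ` and `h`. -/
theorem exists_extSeq_le_pow_mul_exp {σ h : ℝ} (hσ : 1 < σ) (hh : 0 < h) :
    ∃ τ > 0, ∃ R > 1, ∀ x : ℝ, R ≤ |x| →
      ∃ p : ℕ, extSeq τ σ p ≤ |x| ^ p * Real.exp (-h * lambertRate σ x) := by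
  have hs : 0 < σ - 1 := by linarith
  have hσ0 : σ ≠ 0 := by linarith
  -- The factor `4` leaves `2 * h * rate` for `p * log |x|` after rounding, of which the weight
  -- takes at most one half.
  set K := 4 * h with hK
  have hK0 : 0 < K := by positivity
  set τ := h * (σ - 1) / (2 * K ^ σ) with hτ
  have hτ0 : 0 < τ := by positivity
  set w₀ := max 1 (max ((σ - 1) * Real.log K) ((σ - 1) * Real.log (2 / K))) with hw₀
  have hw₀1 : 1 ≤ w₀ := le_max_left _ _
  refine ⟨τ, hτ0, Real.exp (w₀ * Real.exp w₀), ?_, fun x hx => ?_⟩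
  · exact Real.one_lt_exp_iff.2 (by positivity)
  have hxpos : 0 < |x| := (Real.exp_pos _).trans_le hx
  have hlog : w₀ * Real.exp w₀ ≤ Real.log |x| := (Real.le_log_iff_exp_le hxpos).2 hx
  have hlog0 : 0 ≤ Real.log |x| := le_trans (by positivity) hlog
  have hw : w₀ ≤ lambertW (Real.log |x|) := by
    have := lambertW_mono (by positivity) hlog
    rwa [lambertW_eq (by linarith)] at this
  obtain ⟨-, hWe⟩ := lambertW_spec hlog0
  have hrate := lambertRate_eq hσ (by linarith) hlog0
  set w := lambertW (Real.log |x|)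
  set E := Real.exp (w / (σ - 1)) with hE
  have hE0 : 0 < E := Real.exp_pos _
  have hwpos : 0 < w := by linarith
  have hlK : Real.log K ≤ w / (σ - 1) := by
    rw [le_div_iff₀ hs]
    have h1 : (σ - 1) * Real.log K ≤ w₀ := (le_max_left _ _).trans (le_max_right _ _)
    linarith
  have hlK2 : 2 ≤ K * E := by
    have h1 : (σ - 1) * Real.log (2 / K) ≤ w₀ := (le_max_right _ _).trans (le_max_right _ _)
    have h2 : Real.log (2 / K) ≤ w / (σ - 1) := by
      rw [le_div_iff₀ hs]
      linarith
    have h3 := (Real.log_le_iff_le_exp (by positivity)).1 h2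
    rw [div_le_iff₀ hK0] at h3
    linarith
  have hEe : E * Real.exp w = Real.exp (σ * (w / (σ - 1))) := by
    rw [hE, ← Real.exp_add]
    congr 1
    field_simp
    ring
  set p := ⌊K * E⌋₊ with hp
  have hple : (p : ℝ) ≤ K * E := Nat.floor_le (by positivity)
  have hpge : K * E / 2 ≤ p := by
    have := Nat.sub_one_lt_floor (K * E)
    linarith
  have hp0 : (0 : ℝ) < p := by linarith
  have hlp0 : 0 ≤ Real.log p := Real.log_natCast_nonneg p
  have hlp : Real.log p ≤ 2 * (w / (σ - 1)) := by
    have := Real.log_le_log hp0 hple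
    rw [Real.log_mul hK0.ne' hE0.ne', hE, Real.log_exp] at this
    linarith
  have hpσ : (p : ℝ) ^ σ ≤ K ^ σ * Real.exp (σ * (w / (σ - 1))) := by
    refine (Real.rpow_le_rpow hp0.le hple (by linarith)).trans_eq ?_
    rw [Real.mul_rpow hK0.le hE0.le, hE, ← Real.exp_mul, mul_comm σ]
  refine ⟨p, ?_⟩
  rw [extSeq_eq_exp hσ0, ← Real.exp_log (pow_pos hxpos p), Real.log_pow, ← Real.exp_add]
  refine Real.exp_le_exp.2 ?_
  have h1 : τ * ((p : ℝ) ^ σ * Real.log p) ≤ h * lambertRate σ x := by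
    calc τ * ((p : ℝ) ^ σ * Real.log p)
        ≤ τ * ((K ^ σ * Real.exp (σ * (w / (σ - 1)))) * (2 * (w / (σ - 1)))) := by gcongr
      _ = h * lambertRate σ x := by
          rw [hrate, hτ]
          field_simp
  have h2 : 2 * h * lambertRate σ x ≤ p * Real.log |x| := by
    calc 2 * h * lambertRate σ x = K * E / 2 * (w * Real.exp w) := by
          rw [hrate, ← hEe, hK]
          ring
      _ ≤ p * (w * Real.exp w) := by gcongr
      _ = p * Real.log |x| := by rw [hWe]
  linarith

/-! ### Decay of the inverse Fourier transform -/

/-- The `L²` Fourier inversion formula for a continuous function with smooth, compactly supported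
Fourier transform, with the inverse transform written as a direct one. -/
theorem IsL2Fourier.eq_fourier {f g : ℝ → ℂ} (h : IsL2Fourier f g) (hf : Continuous f)
    (hg : ContDiff ℝ ∞ g) (hcs : HasCompactSupport g) :
    f = 𝓕 (fun ξ : ℝ => g (2 * Real.pi * ξ)) := by
  obtain ⟨F, hF, hFg⟩ := h
  have hpi := Real.pi_pos
  have hcs' : HasCompactSupport (fun ξ : ℝ => g (-(2 * Real.pi * ξ))) := by
    have := hcs.comp_homeomorph (Homeomorph.mulLeft₀ (-(2 * Real.pi)) (by linarith))
    convert this using 2 with ξ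
    simp
  set G : SchwartzMap ℝ ℂ := hcs'.toSchwartzMap (hg.comp (by fun_prop)) with hG
  have hGc : ∀ ξ, G ξ = g (-(2 * Real.pi * ξ)) := fun ξ => rfl
  have h1 : (𝓕 F : Lp ℂ 2 (volume : Measure ℝ)) = G.toLp 2 := by
    refine Lp.ext (hFg.trans ?_)
    filter_upwards [G.coeFn_toLp 2 volume] with ξ hξ
    rw [hξ, hGc]
  have h2 : F = (𝓕⁻ G).toLp 2 := by
    rw [← SchwartzMap.toLp_fourierInv_eq, ← h1, FourierTransform.fourierInv_fourier_eq]
  have h3 : f =ᵐ[volume] (𝓕⁻ G : SchwartzMap ℝ ℂ) := by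
    refine hF.symm.trans ?_
    rw [h2]
    exact (𝓕⁻ G).coeFn_toLp 2 volume
  have h4 : f = (𝓕⁻ G : SchwartzMap ℝ ℂ) :=
    (Continuous.ae_eq_iff_eq volume hf (𝓕⁻ G).continuous).1 h3
  rw [h4, SchwartzMap.fourierInv_coe]
  rw [Real.fourierInv_eq_fourier_comp_neg]
  congr 1
  funext ξ
  rw [hGc, mul_neg, neg_neg]

theorem add_one_le_two_pow (k : ℕ) : (k : ℝ) + 1 ≤ 2 ^ k := by
  exact_mod_cast Nat.succ_le_of_lt k.lt_two_pow_self

/-- Derivatives of the Fourier transform of a compactly supported extended Gevrey function `f`.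
The constant depends on the order `k` of the derivative only through the geometric factor
`C ^ (k + 1)`, because `𝓕 f` is of exponential type. -/
theorem pow_mul_iteratedDeriv_fourier_le {σ τ : ℝ} {f : ℝ → ℂ} (hσ : 1 < σ) (hτ : 0 < τ)
    (hf : f ∈ UnifExtGevrey σ) (hcs : HasCompactSupport f) :
    ∃ C > 0, ∀ (k p : ℕ) (x : ℝ),
      |x| ^ p * ‖iteratedDeriv k (𝓕 f) x‖ ≤ C ^ (k + 1) * extSeq τ σ p := by
  have hσ0 : σ ≠ 0 := by linarith
  have hτ2 := half_pos hτ
  have hpi := Real.pi_pos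
  obtain ⟨A₀, hA₀⟩ := hcs.isBounded.subset_closedBall (0 : ℝ)
  set A := max A₀ 1 with hA
  have hA1 : 1 ≤ A := le_max_right _ _
  have hsub : tsupport f ⊆ Metric.closedBall 0 A :=
    hA₀.trans (Metric.closedBall_subset_closedBall (le_max_left _ _))
  obtain ⟨B, hB, hfb⟩ := hf.2 _ hτ2
  have hpos := extSeq_pos (τ := τ / 2) hσ0
  obtain ⟨D, hD, hDb⟩ := pow_mul_factorial_le_extSeq (c := 2) hσ (by norm_num) hτ2
  have hzero : ∀ j (v : ℝ), v ∉ Metric.closedBall (0 : ℝ) A → iteratedFDeriv ℝ j f v = 0 := by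
    intro j v hv
    by_contra hne
    exact hv (hsub (support_iteratedFDeriv_subset j hne))
  have hint : ∀ i j : ℕ, Integrable (fun v : ℝ => ‖v‖ ^ i * ‖iteratedFDeriv ℝ j f v‖) := by
    intro i j
    refine Continuous.integrable_of_hasCompactSupport ?_ ?_
    · exact (continuous_norm.pow i).mul
        (hf.1.continuous_iteratedFDeriv (by exact_mod_cast le_top)).norm
    · exact (hcs.iteratedFDeriv j).norm.mul_left
  have hI : ∀ k p i j : ℕ, i ≤ k → j ≤ p →
      ∫ v : ℝ, ‖v‖ ^ i * ‖iteratedFDeriv ℝ j f v‖ ≤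
        A ^ k * (B * extSeq (τ / 2) σ p) * (2 * A) := by
    intro k p i j hik hjp
    have hbound : ∀ v ∈ Metric.closedBall (0 : ℝ) A,
        ‖(‖v‖ ^ i * ‖iteratedFDeriv ℝ j f v‖)‖ ≤ A ^ k * (B * extSeq (τ / 2) σ p) := by
      intro v hv
      rw [mem_closedBall_zero_iff] at hv
      rw [Real.norm_of_nonneg (by positivity), norm_iteratedFDeriv_eq_norm_iteratedDeriv]
      have h1 : ‖v‖ ^ i ≤ A ^ k :=
        (pow_le_pow_left₀ (norm_nonneg v) hv i).trans (pow_le_pow_right₀ hA1 hik)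
      have h2 : ‖iteratedDeriv j f v‖ ≤ B * extSeq (τ / 2) σ p :=
        (hfb j v).trans
          (mul_le_mul_of_nonneg_left (extSeq_mono (by linarith) hτ2.le hjp) hB.le)
      exact mul_le_mul h1 h2 (norm_nonneg _) (by positivity)
    have hset : ∫ v : ℝ, ‖v‖ ^ i * ‖iteratedFDeriv ℝ j f v‖ =
        ∫ v in Metric.closedBall (0 : ℝ) A, ‖v‖ ^ i * ‖iteratedFDeriv ℝ j f v‖ := by
      refine (setIntegral_eq_integral_of_forall_compl_eq_zero fun v hv => ?_).symm
      rw [hzero j v hv, norm_zero, mul_zero]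
    rw [hset]
    have hvol : (volume (Metric.closedBall (0 : ℝ) A)) = ENNReal.ofReal (2 * A) :=
      Real.volume_closedBall 0 A
    have := norm_setIntegral_le_of_norm_le_const (μ := volume)
      (by rw [hvol]; exact ENNReal.ofReal_lt_top) hbound
    rw [Measure.real, hvol, ENNReal.toReal_ofReal (by linarith)] at this
    exact (le_abs_self _).trans this
  -- `C₁` collects the factors that are geometric in `k`, `C₂` the constant ones.
  set C₁ := 2 * Real.pi * Real.exp 2 * 2 * A with hC₁
  set C₂ := Real.exp 2 * B * (2 * A) * D with hC₂
  have hC₁0 : 0 < C₁ := by positivity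
  have hC₂0 : 0 < C₂ := by positivity
  refine ⟨max C₁ (max C₂ 1), by positivity, fun k p x => ?_⟩
  have hmain := Real.pow_mul_norm_iteratedFDeriv_fourier_le (K := ⊤) (N := ⊤) (f := f) hf.1
    (fun i j _ _ => hint i j) (k := k) (n := p) le_top le_top x
  rw [norm_iteratedFDeriv_eq_norm_iteratedDeriv, Real.norm_eq_abs] at hmain
  have hsum : ∑ q ∈ Finset.range (k + 1) ×ˢ Finset.range (p + 1),
      ∫ v : ℝ, ‖v‖ ^ q.1 * ‖iteratedFDeriv ℝ q.2 f v‖ ≤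
        2 ^ k * 2 ^ p * (A ^ k * (B * extSeq (τ / 2) σ p) * (2 * A)) := by
    have hp0 := hpos p
    refine (Finset.sum_le_card_nsmul _ _ (A ^ k * (B * extSeq (τ / 2) σ p) * (2 * A))
      fun q hq => ?_).trans ?_
    · rw [Finset.mem_product, Finset.mem_range, Finset.mem_range] at hq
      exact hI k p q.1 q.2 (by omega) (by omega)
    · rw [Finset.card_product, Finset.card_range, Finset.card_range, nsmul_eq_mul]
      push_cast
      have h1 := add_one_le_two_pow k
      have h2 := add_one_le_two_pow p
      gcongr
  -- The factor `(2 k + 2) ^ p` is not geometric in `k`, but `t ^ p ≤ p! * exp t`.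
  have hexp : (2 * (k : ℝ) + 2) ^ p ≤ p.factorial * (Real.exp 2 ^ k * Real.exp 2) := by
    have h1 := Real.pow_div_factorial_le_exp (2 * (k : ℝ) + 2) (by positivity) p
    rw [div_le_iff₀ (by positivity)] at h1
    refine h1.trans_eq ?_
    rw [Real.exp_add, mul_comm 2 (k : ℝ), Real.exp_nat_mul, mul_comm]
  have hp0 := hpos p
  have hp1 := extSeq_pos (τ := τ) hσ0 p
  calc |x| ^ p * ‖iteratedDeriv k (𝓕 f) x‖
      ≤ (2 * Real.pi) ^ k * (2 * (k : ℝ) + 2) ^ p *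
          ∑ q ∈ Finset.range (k + 1) ×ˢ Finset.range (p + 1),
            ∫ v : ℝ, ‖v‖ ^ q.1 * ‖iteratedFDeriv ℝ q.2 f v‖ := hmain
    _ ≤ (2 * Real.pi) ^ k * (p.factorial * (Real.exp 2 ^ k * Real.exp 2)) *
          (2 ^ k * 2 ^ p * (A ^ k * (B * extSeq (τ / 2) σ p) * (2 * A))) := by
        gcongr
    _ = C₁ ^ k * (Real.exp 2 * B * (2 * A)) * (2 ^ p * p.factorial) * extSeq (τ / 2) σ p := by
        rw [hC₁]
        simp only [mul_pow]
        ring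
    _ ≤ C₁ ^ k * (Real.exp 2 * B * (2 * A)) * (D * extSeq (τ / 2) σ p) * extSeq (τ / 2) σ p := by
        refine mul_le_mul_of_nonneg_right ?_ hp0.le
        exact mul_le_mul_of_nonneg_left (hDb p) (by positivity)
    _ = C₁ ^ k * C₂ * (extSeq (τ / 2) σ p * extSeq (τ / 2) σ p) := by
        rw [hC₂]
        ring
    _ = C₁ ^ k * C₂ * extSeq τ σ p := by rw [extSeq_mul_extSeq hσ0, add_halves]
    _ ≤ max C₁ (max C₂ 1) ^ (k + 1) * extSeq τ σ p := by
        rw [pow_succ]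
        have h1 : C₁ ≤ max C₁ (max C₂ 1) := le_max_left _ _
        have h2 : C₂ ≤ max C₁ (max C₂ 1) := (le_max_left _ _).trans (le_max_right _ _)
        gcongr

/-- Decay of all derivatives, with a geometric dependence on the order; both decay estimates of the
theorem are special cases. -/
theorem IsL2Fourier.exists_norm_iteratedDeriv_le {σ h : ℝ} {ψ ψhat : ℝ → ℂ} (hσ : 1 < σ)
    (hh : 0 < h) (hψ : Continuous ψ) (hfour : IsL2Fourier ψ ψhat)
    (hD : ψhat ∈ DSigma (E := ℂ) σ) :
    ∃ C : ℝ, 0 < C ∧ ∃ R : ℝ, 0 < R ∧ ∀ (n : ℕ) (x : ℝ), R ≤ |x| →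
      ‖iteratedDeriv n ψ x‖ ≤ C ^ (n + 1) * Real.exp (-h * lambertRate σ x) := by
  have hu := unifExtGevrey_of_mem_DSigma (by linarith) hD
  have hcs := hasCompactSupport_of_mem_DSigma hD
  have hcs' : HasCompactSupport (fun ξ : ℝ => ψhat (2 * Real.pi * ξ)) :=
    hcs.comp_homeomorph (Homeomorph.mulLeft₀ (2 * Real.pi) (by positivity))
  obtain ⟨τ, hτ, R, hR, hopt⟩ := exists_extSeq_le_pow_mul_exp hσ hh
  obtain ⟨C, hC, hb⟩ := pow_mul_iteratedDeriv_fourier_le hσ hτ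
    (UnifExtGevrey.comp_const_mul hσ hu (2 * Real.pi)) hcs'
  refine ⟨C, hC, R, by linarith, fun n x hx => ?_⟩
  obtain ⟨p, hp⟩ := hopt x hx
  have hxp : 0 < |x| ^ p := pow_pos (by linarith) p
  rw [hfour.eq_fourier hψ hu.1 hcs]
  refine le_of_mul_le_mul_left ?_ hxp
  calc _ ≤ C ^ (n + 1) * extSeq τ σ p := hb n p x
    _ ≤ C ^ (n + 1) * (|x| ^ p * Real.exp (-h * lambertRate σ x)) := by gcongr
    _ = |x| ^ p * (C ^ (n + 1) * Real.exp (-h * lambertRate σ x)) := by ring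

theorem theorem3p1 (σ : ℝ) (hσ : 1 < σ) (ψ ψhat : ℝ → ℂ)
    (hsmooth : ContDiff ℝ ∞ ψ) (hwav : IsOrthonormalWavelet ψ) (hfour : IsL2Fourier ψ ψhat) :
    (IsBellForm σ ψhat → ψhat ∈ DSigma (E := ℂ) σ) ∧
    (ψhat ∈ DSigma (E := ℂ) σ →
      (∀ n : ℕ, ∀ h : ℝ, 0 < h → ∃ C : ℝ, 0 < C ∧ ∃ R : ℝ, 0 < R ∧ ∀ x : ℝ, R ≤ |x| →
        ‖iteratedDeriv n ψ x‖ ≤ C * Real.exp (-h * lambertRate σ x)) ∧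
      (∀ h : ℝ, 0 < h → ∃ C : ℝ, 0 < C ∧ ∃ R : ℝ, 0 < R ∧ ∀ s : ℝ, 0 < s → s ≤ 1 →
        ∀ n : ℕ, ∀ x : ℝ, R ≤ |x| →
          ‖iteratedDeriv n ψ x‖ ≤
            C ^ (n + 1) * (n.factorial : ℝ) ^ s * Real.exp (-h * lambertRate σ x))) := by
  refine ⟨fun hbell => hbell.mem_DSigma hσ, fun hD => ⟨fun n h hh => ?_, fun h hh => ?_⟩⟩
  · obtain ⟨C, hC, R, hR, hb⟩ := hfour.exists_norm_iteratedDeriv_le hσ hh hsmooth.continuous hD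
    exact ⟨C ^ (n + 1), by positivity, R, hR, hb n⟩
  · obtain ⟨C, hC, R, hR, hb⟩ := hfour.exists_norm_iteratedDeriv_le hσ hh hsmooth.continuous hD
    refine ⟨C, hC, R, hR, fun s hs _ n x hx => (hb n x hx).trans ?_⟩
    have h1 : 1 ≤ (n.factorial : ℝ) ^ s :=
      Real.one_le_rpow (by exact_mod_cast n.factorial_pos) hs.le
    refine mul_le_mul_of_nonneg_right ?_ (Real.exp_pos _).le
    exact le_mul_of_one_le_right (by positivity) h1
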